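/- Let $m\ge 0$ be an integer and let $\{X_i\}_{i\ge1}$ be a non-negative stationary $m$-dependent process, i.e. $(X_{i_1+h},\dots,X_{i_k+h})$ and $(X_{i_1},\dots,X_{i_k})$ have the same distribution for all $k$, $h\ge 0$ and $i_1,\dots,i_k\ge1$, and $\{X_i\}_{i\in A}$ and $\{X_j\}_{j\in B}$ are independent for all $A,B\subset\{1,2,\dots\}$ with $|i-j|>m$ for all $i\in A$, $j\in B$. Put $\mu:=\mathbb E[X_1]$, $\sigma^2:=\mathrm{Var}(X_1)$, $a_j:=\mathrm{Cov}(X_1,X_{1+j})$, and assume $\mu>0$, $\sigma^2>0$, $\sigma^2+2\sum_{j=1}^m a_j>0$ and $\mathbb E|X_1|^3<\infty$. Let $\{Y_i\}_{i\ge1}$ be i.i.d. non-negative integer valued random variables with $\mathbb E[Y_1]>0$, $\mathrm{Var}(Y_1)>0$ and $\mathbb E|Y_1|^3<\infty$, and suppose that the sequences $\{X_i\}$ and $\{Y_i\}$ are independent of each other. Let $N_n=\sum_{i=1}^n Y_i$. Then $$\frac{\sum_{i=1}^{N_n}X_i-N_n\mu}{\sqrt{N_n}\,\sqrt{\sigma^2+2\sum_{j=1}^m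 a_j}}\longrightarrow_d N(0,1)\qquad (n\to\infty),$$ where the quotient is read as $0$ on the event $\{N_n=0\}$. -/

import Mathlib

open MeasureTheory ProbabilityTheory Filter

/-- A discrete-time real process `X 0, X 1, …` is (strictly) stationary: for all `k`, all shifts `h`
and all times `i 0, …, i (k - 1)`, the vectors `(X (i 0 + h), …, X (i (k - 1) + h))` and
`(X (i 0), …, X (i (k - 1)))` have the same joint distribution. -/
def IsStationaryProcess {Ω : Type*} [MeasurableSpace Ω] (X : ℕ → Ω → ℝ) (P : Measure Ω) : Prop :=
  ∀ (k h : ℕ) (i : Fin k → ℕ),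
    IdentDistrib (fun ω (l : Fin k) => X (i l + h) ω) (fun ω (l : Fin k) => X (i l) ω) P P

/-- A process is `m`-dependent: the families `{X i, i ∈ A}` and `{X j, j ∈ B}` are independent
for any two sets of times `A`, `B` at distance larger than `m`, i.e. such that `|i - j| > m` for
all `i ∈ A`, `j ∈ B`. -/
def IsMDependentProcess {Ω : Type*} [MeasurableSpace Ω] (m : ℕ) (X : ℕ → Ω → ℝ)
    (P : Measure Ω) : Prop :=
  ∀ A B : Set ℕ, (∀ i ∈ A, ∀ j ∈ B, (m : ℤ) < |(i : ℤ) - (j : ℤ)|) →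
    IndepFun (fun ω (i : A) => X i ω) (fun ω (j : B) => X j ω) P

/-- The random index `N_n = Y_1 + ⋯ + Y_n`; the sequence is enumerated from `0`, so that
`Y i` is the `(i + 1)`-st variable. -/
def randomIndex {Ω : Type*} (Y : ℕ → Ω → ℕ) (n : ℕ) (ω : Ω) : ℕ :=
  ∑ i ∈ Finset.range n, Y i ω

/-- The random sum `X_1 + ⋯ + X_{N_n}`; the sequence is enumerated from `0`, so that
`X i` is the `(i + 1)`-st variable. -/
noncomputable def randomSum {Ω : Type*} (X : ℕ → Ω → ℝ) (Y : ℕ → Ω → ℕ) (n : ℕ) (ω : Ω) : ℝ :=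
  ∑ i ∈ Finset.range (randomIndex Y n ω), X i ω

/-- The long-run variance `σ² + 2 ∑_{j=1}^m a_j`, with `σ² = Var(X_1)` and
`a_j = Cov(X_1, X_{1+j})`. -/
noncomputable def longRunVariance {Ω : Type*} [MeasurableSpace Ω] (m : ℕ) (X : ℕ → Ω → ℝ)
    (P : Measure Ω) : ℝ :=
  variance (X 0) P + 2 * ∑ j ∈ Finset.Icc 1 m, covariance (X 0) (X j) P

/-! ### Covariance structure of stationary `m`-dependent sequences. -/

section MDependent

open scoped Topology

variable {Ω : Type*} [MeasurableSpace Ω] {P : Measure Ω}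

/-! The core is the CLT for a deterministic number of terms, by Bernstein's blocks. Summation blocks
of length `L` separated by gaps of length `m` give i.i.d. block sums (`iIndepFun_blockSum`), to
which the classical CLT applies. Dropping the gaps costs, after normalisation, an L² error of order
`√(m / (L + m))` as `n → ∞`, because the variance of a sum is at most linear in the number of terms
(`variance_sum_le`). The block variance divided by `L + m` tends to the long-run variance
(`tendsto_variance_sum_range_div`), so letting `n → ∞` and then `L → ∞` gives
`tendsto_charFun_sum_range_div`.

The random index is then harmless: it is independent of `X`, so the characteristic function of the
quotient is the mean of the deterministic ones at `N_n` (`charFun_map_comp_nat_eq_integral`). Since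
`N_n → ∞` almost surely by the strong law, dominated convergence and Lévy's continuity theorem
conclude. -/

lemma iIndepFun_of_indepFun_Iio {β : Type*} [MeasurableSpace β] [IsProbabilityMeasure P]
    {f : ℕ → Ω → β} (h : ∀ n, IndepFun (fun ω (i : Set.Iio n) => f i ω) (f n) P) :
    iIndepFun f P := by
  rw [iIndepFun_iff_measure_inter_preimage_eq_mul]
  intro S
  -- Adding indices in increasing order makes all earlier ones lie in `Iio a`, where the hypothesis
  -- applies.
  induction S using Finset.induction_on_max with
  | empty => simp
  | insert a S ha ih =>
    intro sets hsets
    have haS : a ∉ S := fun h => lt_irrefl _ (ha a h)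
    rw [Finset.prod_insert haS, ← ih fun i hi => hsets i (Finset.mem_insert_of_mem hi)]
    have hcyl : MeasurableSet {x : Set.Iio a → β | ∀ i : Set.Iio a, (i : ℕ) ∈ S → x i ∈ sets i} := by
      simp only [Set.ofPred_forall]
      refine MeasurableSet.iInter fun i => MeasurableSet.iInter fun hi => ?_
      exact measurable_pi_apply i (hsets i (Finset.mem_insert_of_mem hi))
    have key := (h a).measure_inter_preimage_eq_mul _ _ hcyl (hsets a (Finset.mem_insert_self _ _))
    have hpre : (fun ω (i : Set.Iio a) => f i ω) ⁻¹'
        {x : Set.Iio a → β | ∀ i : Set.Iio a, (i : ℕ) ∈ S → x i ∈ sets i} =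
        ⋂ i ∈ S, f i ⁻¹' sets i := by
      ext ω
      simp only [Set.mem_preimage, Set.mem_ofPred_eq, Set.mem_iInter]
      exact ⟨fun H i hi => H ⟨i, ha i hi⟩ hi, fun H i hi => H i hi⟩
    rw [hpre] at key
    rw [Finset.set_biInter_insert, Set.inter_comm, key, mul_comm]

/-- The map `x ↦ exp (i x)` is 1-Lipschitz, and the L¹ norm is at most the L² norm. Two frequencies
are allowed so that one bound covers both dropping the gaps and changing the normalisation. -/
lemma norm_charFun_map_sub_charFun_map_le [IsProbabilityMeasure P] {U V : Ω → ℝ}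
    (hU : MemLp U 2 P) (hV : MemLp V 2 P) (a b : ℝ) :
    ‖charFun (P.map U) a - charFun (P.map V) b‖ ≤ √(∫ ω, (a * U ω - b * V ω) ^ 2 ∂P) := by
  have hW : MemLp (fun ω => a * U ω - b * V ω) 2 P := (hU.const_mul a).sub (hV.const_mul b)
  have hexp (c : ℝ) {W : Ω → ℝ} (hW : MemLp W 2 P) :
      Integrable (fun ω => Complex.exp (c * W ω * Complex.I)) P := by
    have := hW.aemeasurable
    refine Integrable.of_bound (by fun_prop) 1 (ae_of_all _ fun ω => ?_)
    rw [← Complex.ofReal_mul, Complex.norm_exp_ofReal_mul_I]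
  have hmap (c : ℝ) {W : Ω → ℝ} (hW : MemLp W 2 P) :
      charFun (P.map W) c = ∫ ω, Complex.exp (c * W ω * Complex.I) ∂P := by
    rw [charFun_apply_real, integral_map hW.aemeasurable (by fun_prop)]
  rw [hmap a hU, hmap b hV, ← integral_sub (hexp a hU) (hexp b hV)]
  have hpt (ω : Ω) : ‖Complex.exp (a * U ω * Complex.I) - Complex.exp (b * V ω * Complex.I)‖ ≤
      |a * U ω - b * V ω| := by
    have h1 : Complex.exp (a * U ω * Complex.I) - Complex.exp (b * V ω * Complex.I) =
        Complex.exp ((b * V ω : ℝ) * Complex.I) *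
          (Complex.exp (Complex.I * (a * U ω - b * V ω : ℝ)) - 1) := by
      rw [mul_sub, ← Complex.exp_add]
      push_cast
      ring_nf
    rw [h1, norm_mul, Complex.norm_exp_ofReal_mul_I, one_mul]
    exact Real.norm_exp_I_mul_ofReal_sub_one_le
  calc _ ≤ ∫ ω, ‖Complex.exp (a * U ω * Complex.I) - Complex.exp (b * V ω * Complex.I)‖ ∂P :=
        norm_integral_le_integral_norm _
    _ ≤ ∫ ω, |a * U ω - b * V ω| ∂P :=
        integral_mono ((hexp a hU).sub (hexp b hV)).norm
          (hW.integrable one_le_two).abs hpt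
    _ ≤ _ := by
        refine Real.le_sqrt_of_sq_le ?_
        -- Nonnegativity of this variance is `(E|W|)² ≤ E W²`.
        have h2 := variance_nonneg (fun ω => |a * U ω - b * V ω|) P
        rw [variance_eq_sub (by exact hW.abs)] at h2
        simpa using h2

lemma abs_covariance_le_of_variance_eq [IsProbabilityMeasure P] {U V : Ω → ℝ} {s : ℝ}
    (hU : MemLp U 2 P) (hV : MemLp V 2 P) (hUs : variance U P = s) (hVs : variance V P = s) :
    |covariance U V P| ≤ s := by
  have h1 := variance_nonneg (U + V) P
  have h2 := variance_nonneg (U - V) P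
  rw [variance_add hU hV] at h1
  rw [variance_sub hU hV] at h2
  rw [abs_le]
  constructor <;> linarith

variable {X : ℕ → Ω → ℝ} {m : ℕ}

lemma IsStationaryProcess.identDistrib_zero (h : IsStationaryProcess X P) (i : ℕ) :
    IdentDistrib (X i) (X 0) P P := by
  have := (h 1 i fun _ => 0).comp (measurable_pi_apply (0 : Fin 1))
  simpa [Function.comp_def] using this

lemma IsStationaryProcess.identDistrib_sum_range (h : IsStationaryProcess X P) (k L : ℕ) :
    IdentDistrib (fun ω => ∑ i ∈ Finset.range L, X (i + k) ω)
      (fun ω => ∑ i ∈ Finset.range L, X i ω) P P := by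
  have := (h L k fun i => i).comp (u := fun x : Fin L → ℝ => ∑ i, x i) (by fun_prop)
  simpa only [Function.comp_def, ← Fin.sum_univ_eq_sum_range] using this

lemma IsStationaryProcess.covariance_add (h : IsStationaryProcess X P) (i j k : ℕ) :
    covariance (X (i + k)) (X (j + k)) P = covariance (X i) (X j) P := by
  have hm (l : ℕ) : ∫ ω, X l ω ∂P = ∫ ω, X 0 ω ∂P := (h.identDistrib_zero l).integral_eq
  have := ((h 2 k ![i, j]).comp (u := fun x : Fin 2 → ℝ =>
    (x 0 - ∫ ω, X 0 ω ∂P) * (x 1 - ∫ ω, X 0 ω ∂P)) (by fun_prop)).integral_eq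
  simpa [covariance, hm] using this

lemma IsStationaryProcess.memLp (h : IsStationaryProcess X P) {q : ENNReal} (h0 : MemLp (X 0) q P)
    (i : ℕ) : MemLp (X i) q P :=
  (h.identDistrib_zero i).memLp_iff.2 h0

lemma IsStationaryProcess.comp (h : IsStationaryProcess X P) {f : ℝ → ℝ} (hf : Measurable f) :
    IsStationaryProcess (fun i ω => f (X i ω)) P := by
  intro k l i
  exact (h k l i).comp (u := fun x (j : Fin k) => f (x j)) (by fun_prop)

lemma IsMDependentProcess.comp (h : IsMDependentProcess m X P) {f : ℝ → ℝ} (hf : Measurable f) :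
    IsMDependentProcess m (fun i ω => f (X i ω)) P := by
  intro A B hAB
  exact (h A B hAB).comp (φ := fun x (i : A) => f (x i)) (ψ := fun x (i : B) => f (x i))
    (by fun_prop) (by fun_prop)

lemma IsMDependentProcess.covariance_eq_zero [IsProbabilityMeasure P]
    (h : IsMDependentProcess m X P) (hX : ∀ i, MemLp (X i) 2 P) {i j : ℕ} (hij : i + m < j) :
    covariance (X i) (X j) P = 0 := by
  have hi := h {i} {j} (by
    rintro _ rfl _ rfl
    rw [lt_abs]; omega)
  have := hi.comp (measurable_pi_apply (⟨i, rfl⟩ : ({i} : Set ℕ)))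
    (measurable_pi_apply (⟨j, rfl⟩ : ({j} : Set ℕ)))
  exact IndepFun.covariance_eq_zero this (hX i) (hX j)

/-- Each row of the covariance matrix has at most `2 * m + 1` nonzero entries, each bounded by the
common variance. -/
lemma IsMDependentProcess.variance_sum_le [IsProbabilityMeasure P]
    (h : IsMDependentProcess m X P) (hs : IsStationaryProcess X P) (h0 : MemLp (X 0) 2 P)
    (F : Finset ℕ) :
    variance (fun ω => ∑ i ∈ F, X i ω) P ≤ F.card * ((2 * m + 1) * variance (X 0) P) := by
  have hX := hs.memLp h0
  have hvar (i : ℕ) : variance (X i) P = variance (X 0) P := (hs.identDistrib_zero i).variance_eq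
  rw [variance_fun_sum' fun i _ => hX i, ← nsmul_eq_mul]
  refine Finset.sum_le_card_nsmul _ _ _ fun i _ => ?_
  have hzero : ∀ j ∈ F, j ∉ F.filter (fun j => j ∈ Finset.Icc (i - m) (i + m)) →
      covariance (X i) (X j) P = 0 := by
    intro j hj hj'
    simp only [Finset.mem_filter, hj, true_and, Finset.mem_Icc, not_and_or, not_le] at hj'
    rcases hj' with hj' | hj'
    · rw [covariance_comm]
      exact h.covariance_eq_zero hX (by omega)
    · exact h.covariance_eq_zero hX hj'
  rw [← Finset.sum_subset (Finset.filter_subset _ F) hzero]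
  calc _ ≤ ∑ j ∈ F.filter (fun j => j ∈ Finset.Icc (i - m) (i + m)), variance (X 0) P :=
        Finset.sum_le_sum fun j _ => (le_abs_self _).trans
          (abs_covariance_le_of_variance_eq (hX i) (hX j) (hvar i) (hvar j))
    _ ≤ ∑ j ∈ Finset.Icc (i - m) (i + m), variance (X 0) P :=
        Finset.sum_le_sum_of_subset_of_nonneg (fun j hj => (Finset.mem_filter.1 hj).2)
          fun _ _ _ => variance_nonneg _ _
    _ ≤ _ := by
        rw [Finset.sum_const, Nat.card_Icc, nsmul_eq_mul]
        refine mul_le_mul_of_nonneg_right ?_ (variance_nonneg _ _)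
        exact_mod_cast (by omega : i + m + 1 - (i - m) ≤ 2 * m + 1)

/-- Once `m ≤ L`, the new variable sees all `m` lags with nonzero covariance, so the increment no
longer depends on `L`. -/
lemma IsMDependentProcess.variance_sum_range_succ [IsProbabilityMeasure P]
    (h : IsMDependentProcess m X P) (hs : IsStationaryProcess X P) (h0 : MemLp (X 0) 2 P)
    {L : ℕ} (hL : m ≤ L) :
    variance (fun ω => ∑ i ∈ Finset.range (L + 1), X i ω) P =
      variance (fun ω => ∑ i ∈ Finset.range L, X i ω) P + longRunVariance m X P := by
  have hX := hs.memLp h0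
  simp only [Finset.sum_range_succ]
  rw [variance_fun_add (memLp_finsetSum _ fun i _ => hX i) (hX L),
    covariance_fun_sum_left' (fun i _ => hX i) (hX L), (hs.identDistrib_zero L).variance_eq]
  have hcov : ∑ i ∈ Finset.range L, covariance (X i) (X L) P =
      ∑ j ∈ Finset.Icc 1 m, covariance (X 0) (X j) P := by
    have h1 : ∑ i ∈ Finset.range L, covariance (X i) (X L) P =
        ∑ j ∈ Finset.range L, covariance (X 0) (X (j + 1)) P := by
      rw [← Finset.sum_range_reflect]
      refine Finset.sum_congr rfl fun j hj => ?_
      have hj := Finset.mem_range.1 hj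
      rw [← hs.covariance_add 0 (j + 1) (L - 1 - j)]
      congr <;> omega
    rw [h1, ← Finset.sum_subset (Finset.range_mono hL), Finset.range_eq_Ico,
      Finset.sum_Ico_add' (fun j => covariance (X 0) (X j) P) 0 m 1]
    · rfl
    · intro j _ hj
      exact h.covariance_eq_zero hX (by simp at hj; omega)
  rw [hcov, longRunVariance]
  ring

/-- The variance is affine in the length from `m` on. Dividing by the block period `L + m` instead
of `L` does not affect the limit and is what the blocks need. -/
lemma IsMDependentProcess.tendsto_variance_sum_range_div [IsProbabilityMeasure P]
    (h : IsMDependentProcess m X P) (hs : IsStationaryProcess X P) (h0 : MemLp (X 0) 2 P) :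
    Tendsto (fun L : ℕ => variance (fun ω => ∑ i ∈ Finset.range L, X i ω) P / ((L + m : ℕ) : ℝ))
      atTop (𝓝 (longRunVariance m X P)) := by
  have hrec (l : ℕ) : variance (fun ω => ∑ i ∈ Finset.range (l + m), X i ω) P =
      variance (fun ω => ∑ i ∈ Finset.range m, X i ω) P + l * longRunVariance m X P := by
    induction l with
    | zero => simp
    | succ l ih =>
      rw [show l + 1 + m = (l + m) + 1 by ring, h.variance_sum_range_succ hs h0 (by omega), ih]
      push_cast
      ring
  rw [← tendsto_add_atTop_iff_nat m]
  simp only [hrec]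
  set s := variance (fun ω => ∑ i ∈ Finset.range m, X i ω) P
  set v := longRunVariance m X P
  have hinv : Tendsto (fun l : ℕ => (((l + m + m : ℕ) : ℝ))⁻¹) atTop (𝓝 0) :=
    tendsto_inv_atTop_zero.comp (tendsto_natCast_atTop_atTop.comp
      ((tendsto_add_atTop_nat (m + m)).congr fun l => by ring))
  have : Tendsto (fun l : ℕ => v + (s - 2 * m * v) * (((l + m + m : ℕ) : ℝ))⁻¹) atTop
      (𝓝 (v + (s - 2 * m * v) * 0)) := (hinv.const_mul _).const_add _
  rw [mul_zero, add_zero] at this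
  refine this.congr' ?_
  filter_upwards [eventually_ge_atTop 1] with l hl
  have : ((l + m + m : ℕ) : ℝ) ≠ 0 := by positivity
  field_simp
  push_cast
  ring

end MDependent

/-! ### Block decomposition and the CLT for the block sums. -/

section MDependentCLT

open scoped Topology

variable {Ω : Type*} [MeasurableSpace Ω] {P : Measure Ω}
  {X : ℕ → Ω → ℝ} {m : ℕ}

/-- The sum of `L` consecutive variables of the process, the `j`-th such block starting at
`j * (L + m)`. -/
def blockSum (X : ℕ → Ω → ℝ) (m L j : ℕ) (ω : Ω) : ℝ :=
  ∑ i ∈ Finset.range L, X (i + j * (L + m)) ω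

/-- Blocks before the `n`-th use only indices `i` with `i + m < n * (L + m)`, hence are more than
`m` away from it. -/
lemma IsMDependentProcess.iIndepFun_blockSum [IsProbabilityMeasure P]
    (h : IsMDependentProcess m X P) (L : ℕ) :
    iIndepFun (blockSum X m L) P := by
  refine iIndepFun_of_indepFun_Iio fun n => ?_
  have hind := h {i | i + m < n * (L + m)} {i | n * (L + m) ≤ i} (by
    intro i hi j hj
    simp only [Set.mem_ofPred_eq] at hi hj
    rw [lt_abs]
    omega)
  have hmem (j : Set.Iio n) (i : Fin L) : (i : ℕ) + j * (L + m) + m < n * (L + m) := by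
    have h1 : ((j : ℕ) + 1) * (L + m) ≤ n * (L + m) := Nat.mul_le_mul_right _ j.2
    have := i.2
    rw [add_mul] at h1
    omega
  have := hind.comp
    (φ := fun x (j : Set.Iio n) => ∑ i : Fin L, x ⟨(i : ℕ) + j * (L + m), hmem j i⟩)
    (ψ := fun x => ∑ i : Fin L, x ⟨(i : ℕ) + n * (L + m), Nat.le_add_left _ _⟩)
    (by fun_prop) (by fun_prop)
  have hblock (j : ℕ) : blockSum X m L j = fun ω => ∑ i : Fin L, X (i + j * (L + m)) ω :=
    funext fun ω => (Fin.sum_univ_eq_sum_range (fun i => X (i + j * (L + m)) ω) L).symm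
  simp only [hblock]
  exact this

lemma IsStationaryProcess.identDistrib_blockSum (hs : IsStationaryProcess X P) (L j : ℕ) :
    IdentDistrib (blockSum X m L j) (blockSum X m L 0) P P :=
  (hs.identDistrib_sum_range _ L).trans (hs.identDistrib_sum_range _ L).symm

lemma IsMDependentProcess.tendsto_charFun_sum_blockSum [IsProbabilityMeasure P]
    (h : IsMDependentProcess m X P) (hs : IsStationaryProcess X P)
    (h0 : MemLp (X 0) 2 P) (hmean : ∫ ω, X 0 ω ∂P = 0)
    (L : ℕ) (t : ℝ) :
    Tendsto (fun k : ℕ => charFun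
        (P.map fun ω => (√k)⁻¹ * ∑ j ∈ Finset.range k, blockSum X m L j ω) t) atTop
      (𝓝 (Complex.exp (-(variance (blockSum X m L 0) P * t ^ 2 / 2 : ℝ)))) := by
  have hX := hs.memLp h0
  have hB : MemLp (blockSum X m L 0) 2 P := memLp_finsetSum _ fun i _ => hX _
  have hB0 : ∫ ω, blockSum X m L 0 ω ∂P = 0 := by
    simp only [blockSum]
    rw [integral_finsetSum _ fun i _ => (hX _).integrable one_le_two]
    exact Finset.sum_eq_zero fun i _ => by rw [(hs.identDistrib_zero _).integral_eq, hmean]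
  have hclt := tendstoInDistribution_inv_sqrt_mul_sum_sub
    (P' := gaussianReal 0 (variance (blockSum X m L 0) P).toNNReal) (Y := id)
    ⟨aemeasurable_id, Measure.map_id⟩ hB (h.iIndepFun_blockSum L)
    fun j => hs.identDistrib_blockSum L j
  have := ProbabilityMeasure.tendsto_iff_tendsto_charFun.1 hclt.tendsto t
  simp only [hB0, mul_zero, sub_zero, ProbabilityMeasure.coe_mk, Measure.map_id,
    charFun_gaussianReal, Real.coe_toNNReal _ (variance_nonneg _ _)] at this
  convert this using 3
  push_cast
  simp

/-- The indices below `n` outside the first `n / (L + m)` blocks. -/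
def blockGaps (m L n : ℕ) : Finset ℕ :=
  (Finset.range n).filter fun i => ¬(i / (L + m) < n / (L + m) ∧ i % (L + m) < L)

lemma sum_range_sub_sum_blockSum {Ω : Type*} (X : ℕ → Ω → ℝ) (m L n : ℕ) (ω : Ω) :
    ∑ i ∈ Finset.range n, X i ω - ∑ j ∈ Finset.range (n / (L + m)), blockSum X m L j ω =
      ∑ i ∈ blockGaps m L n, X i ω := by
  rw [sub_eq_iff_eq_add', blockGaps, ← Finset.sum_filter_add_sum_filter_not (Finset.range n)
    (fun i => i / (L + m) < n / (L + m) ∧ i % (L + m) < L)]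
  congr 1
  simp only [blockSum]
  rw [← Finset.sum_product', eq_comm]
  refine Finset.sum_bij' (fun q _ => q.2 + q.1 * (L + m)) (fun i _ => (i / (L + m), i % (L + m)))
    ?_ ?_ ?_ ?_ ?_
  · rintro ⟨j, i⟩ hq
    simp only [Finset.mem_product, Finset.mem_range] at hq
    have hp : 0 < L + m := by omega
    have hi : i < L + m := by omega
    have hd : (i + j * (L + m)) / (L + m) = j := by
      rw [Nat.add_mul_div_right _ _ hp, Nat.div_eq_of_lt hi, zero_add]
    simp only [Finset.mem_filter, Finset.mem_range, hd, Nat.add_mul_mod_self_right,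
      Nat.mod_eq_of_lt hi]
    refine ⟨?_, hq⟩
    have h1 : (j + 1) * (L + m) ≤ n / (L + m) * (L + m) := Nat.mul_le_mul_right _ hq.1
    have h2 := Nat.div_mul_le_self n (L + m)
    rw [add_mul] at h1
    omega
  · intro i hi
    simpa using (Finset.mem_filter.1 hi).2
  · rintro ⟨j, i⟩ hq
    simp only [Finset.mem_product, Finset.mem_range] at hq
    have hp : 0 < L + m := by omega
    have hi : i < L + m := by omega
    rw [Nat.add_mul_div_right _ _ hp, Nat.div_eq_of_lt hi, zero_add, Nat.add_mul_mod_self_right,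
      Nat.mod_eq_of_lt hi]
  · intro i _
    exact Nat.mod_add_div' i (L + m)
  · intros
    rfl

/-- There are `m` indices per complete period, plus an incomplete last period of fewer than `L + m`.
-/
lemma card_blockGaps_le {m L : ℕ} (hp : 0 < L + m) (n : ℕ) :
    (blockGaps m L n).card ≤ n / (L + m) * m + (L + m) := by
  have hsub : blockGaps m L n ⊆
      (Finset.range (n / (L + m)) ×ˢ Finset.range m).image (fun q => q.2 + L + q.1 * (L + m)) ∪
        (Finset.range (L + m)).image (fun i => i + n / (L + m) * (L + m)) := by
    intro i hi
    simp only [blockGaps, Finset.mem_filter, Finset.mem_range] at hi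
    obtain ⟨hin, hi⟩ := hi
    have hmod := Nat.mod_lt i hp
    have hdiv := Nat.mod_add_div' i (L + m)
    have hle : i / (L + m) ≤ n / (L + m) := Nat.div_le_div_right hin.le
    simp only [Finset.mem_union, Finset.mem_image, Finset.mem_product, Finset.mem_range,
      Prod.exists]
    rcases hle.lt_or_eq with hlt | heq
    · exact Or.inl ⟨i / (L + m), i % (L + m) - L, ⟨hlt, by omega⟩, by omega⟩
    · exact Or.inr ⟨i % (L + m), hmod, by rw [← heq]; exact hdiv⟩
  refine (Finset.card_le_card hsub).trans ((Finset.card_union_le _ _).trans ?_)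
  refine add_le_add (Finset.card_image_le.trans ?_) (Finset.card_image_le.trans ?_) <;> simp

lemma tendsto_natDiv_div_atTop (p : ℕ) :
    Tendsto (fun n : ℕ => ((n / p : ℕ) : ℝ) / n) atTop (𝓝 (1 / p)) := by
  have h := (tendsto_nat_floor_mul_div_atTop (R := ℝ) (a := 1 / p) (by positivity)).comp
    tendsto_natCast_atTop_atTop
  refine h.congr fun n => ?_
  simp only [Function.comp_apply]
  rw [one_div_mul_eq_div, Nat.floor_div_eq_div]

end MDependentCLT

/-! ### The CLT for a deterministic number of terms. -/

section CentralLimit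

open scoped Topology

variable {Ω : Type*} [MeasurableSpace Ω] {P : Measure Ω} {X : ℕ → Ω → ℝ} {m : ℕ}

lemma integral_sq_of_integral_eq_zero {U : Ω → ℝ} (hU : AEMeasurable U P)
    (h : ∫ ω, U ω ∂P = 0) : ∫ ω, U ω ^ 2 ∂P = variance U P :=
  (variance_of_integral_eq_zero hU h).symm

lemma IsMDependentProcess.norm_charFun_sum_range_sub_sum_blockSum_le [IsProbabilityMeasure P]
    (h : IsMDependentProcess m X P) (hs : IsStationaryProcess X P) (h0 : MemLp (X 0) 2 P)
    (hmean : ∫ ω, X 0 ω ∂P = 0) {L : ℕ} (hp : 0 < L + m) (n : ℕ) (a : ℝ) :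
    ‖charFun (P.map fun ω => ∑ i ∈ Finset.range n, X i ω) a -
      charFun (P.map fun ω => ∑ j ∈ Finset.range (n / (L + m)), blockSum X m L j ω) a‖ ≤
      |a| * √(((n / (L + m) : ℕ) * m + (L + m)) * ((2 * m + 1) * variance (X 0) P)) := by
  have hX := hs.memLp h0
  have hsum (F : Finset ℕ) : MemLp (fun ω => ∑ i ∈ F, X i ω) 2 P :=
    memLp_finsetSum _ fun i _ => hX i
  have hint (F : Finset ℕ) : ∫ ω, ∑ i ∈ F, X i ω ∂P = 0 := by
    rw [integral_finsetSum _ fun i _ => (hX i).integrable one_le_two]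
    exact Finset.sum_eq_zero fun i _ => by rw [(hs.identDistrib_zero i).integral_eq, hmean]
  have hB : MemLp (fun ω => ∑ j ∈ Finset.range (n / (L + m)), blockSum X m L j ω) 2 P :=
    memLp_finsetSum _ fun j _ => memLp_finsetSum _ fun i _ => hX _
  refine (norm_charFun_map_sub_charFun_map_le (hsum _) hB a a).trans ?_
  have hsq : ∫ ω, (a * ∑ i ∈ Finset.range n, X i ω -
      a * ∑ j ∈ Finset.range (n / (L + m)), blockSum X m L j ω) ^ 2 ∂P =
      a ^ 2 * variance (fun ω => ∑ i ∈ blockGaps m L n, X i ω) P := by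
    simp only [← mul_sub, sum_range_sub_sum_blockSum, mul_pow]
    rw [integral_const_mul, integral_sq_of_integral_eq_zero (hsum _).aemeasurable (hint _)]
  rw [hsq, Real.sqrt_mul (sq_nonneg a), Real.sqrt_sq_eq_abs]
  refine mul_le_mul_of_nonneg_left (Real.sqrt_le_sqrt ?_) (abs_nonneg a)
  refine (h.variance_sum_le hs h0 _).trans ?_
  refine mul_le_mul_of_nonneg_right ?_ (mul_nonneg (by positivity) (variance_nonneg _ _))
  exact_mod_cast card_blockGaps_le hp n

/-- Pays for replacing the normalisation `√n` by `√(k * (L + m))`, where `k = n / (L + m)` is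
rounded down. -/
lemma IsMDependentProcess.norm_charFun_sum_blockSum_sub_le [IsProbabilityMeasure P]
    (h : IsMDependentProcess m X P) (hs : IsStationaryProcess X P) (h0 : MemLp (X 0) 2 P)
    (hmean : ∫ ω, X 0 ω ∂P = 0) (L k : ℕ) (a b : ℝ) :
    ‖charFun (P.map fun ω => ∑ j ∈ Finset.range k, blockSum X m L j ω) a -
      charFun (P.map fun ω => ∑ j ∈ Finset.range k, blockSum X m L j ω) b‖ ≤
      |a - b| * √(k * variance (blockSum X m L 0) P) := by
  have hX := hs.memLp h0
  have hB (j : ℕ) : MemLp (blockSum X m L j) 2 P := memLp_finsetSum _ fun i _ => hX _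
  have hsum : MemLp (fun ω => ∑ j ∈ Finset.range k, blockSum X m L j ω) 2 P :=
    memLp_finsetSum _ fun j _ => hB j
  have hB0 (j : ℕ) : ∫ ω, blockSum X m L j ω ∂P = 0 := by
    simp only [blockSum]
    rw [integral_finsetSum _ fun i _ => (hX _).integrable one_le_two]
    exact Finset.sum_eq_zero fun i _ => by rw [(hs.identDistrib_zero _).integral_eq, hmean]
  have hint : ∫ ω, ∑ j ∈ Finset.range k, blockSum X m L j ω ∂P = 0 := by
    rw [integral_finsetSum _ fun j _ => (hB j).integrable one_le_two]
    exact Finset.sum_eq_zero fun j _ => hB0 j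
  have hvar : variance (fun ω => ∑ j ∈ Finset.range k, blockSum X m L j ω) P =
      k * variance (blockSum X m L 0) P := by
    have := IndepFun.variance_sum (s := Finset.range k) (fun j _ => hB j)
      fun i _ j _ hij => (h.iIndepFun_blockSum L).indepFun hij
    rw [show (fun ω => ∑ j ∈ Finset.range k, blockSum X m L j ω) =
      ∑ j ∈ Finset.range k, blockSum X m L j by ext; simp, this,
      Finset.sum_congr rfl fun j _ => (hs.identDistrib_blockSum L j).variance_eq]
    simp
  refine (norm_charFun_map_sub_charFun_map_le hsum hsum a b).trans (le_of_eq ?_)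
  simp only [← sub_mul, mul_pow]
  rw [integral_const_mul, integral_sq_of_integral_eq_zero hsum.aemeasurable hint, hvar,
    Real.sqrt_mul (sq_nonneg _), Real.sqrt_sq_eq_abs]

/-- The central limit theorem for centered stationary `m`-dependent sequences, in terms of
characteristic functions. -/
theorem IsMDependentProcess.tendsto_charFun_sum_range_div [IsProbabilityMeasure P]
    (h : IsMDependentProcess m X P) (hs : IsStationaryProcess X P) (h0 : MemLp (X 0) 2 P)
    (hmean : ∫ ω, X 0 ω ∂P = 0) (hv : 0 < longRunVariance m X P) (t : ℝ) :
    Tendsto (fun n : ℕ => charFun (P.map fun ω => ∑ i ∈ Finset.range n, X i ω)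
        (t / (√n * √(longRunVariance m X P)))) atTop
      (𝓝 (Complex.exp (-(t ^ 2 / 2 : ℝ)))) := by
  set v := longRunVariance m X P
  set C := (2 * m + 1) * variance (X 0) P
  let s (L : ℕ) : ℝ := variance (blockSum X m L 0) P
  -- The three terms are the errors from dropping the gaps, from changing the normalisation, and
  -- from the CLT for `n / (L + m)` blocks.
  let g (L n : ℕ) : ℝ :=
    |t| * √((((n / (L + m) : ℕ) : ℝ) / n * m + (L + m) / n) * C / v) +
    |t| * √(s L / v) * |√(((n / (L + m) : ℕ) : ℝ) / n) - √(1 / (L + m : ℕ))| +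
    ‖charFun (P.map fun ω => (√((n / (L + m) : ℕ)))⁻¹ *
      ∑ j ∈ Finset.range (n / (L + m)), blockSum X m L j ω) (t / √((L + m : ℕ) * v)) -
      Complex.exp (-(t ^ 2 / 2 : ℝ))‖
  -- The limit of `g L n` as `n → ∞`, left unsimplified to match `g` term by term; its middle term
  -- is zero.
  let G (L : ℕ) : ℝ := |t| * √((1 / (L + m : ℕ) * m + 0) * C / v) +
    |t| * √(s L / v) * |√(1 / (L + m : ℕ)) - √(1 / (L + m : ℕ))| +
    ‖Complex.exp (-(s L * (t / √((L + m : ℕ) * v)) ^ 2 / 2 : ℝ)) -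
      Complex.exp (-(t ^ 2 / 2 : ℝ))‖
  have hbound (L n : ℕ) (hL : 0 < L) (hn : L + m ≤ n) :
      ‖charFun (P.map fun ω => ∑ i ∈ Finset.range n, X i ω) (t / (√n * √v)) -
        Complex.exp (-(t ^ 2 / 2 : ℝ))‖ ≤ g L n := by
    have hp : 0 < L + m := by omega
    have hk : 0 < n / (L + m) := Nat.div_pos hn hp
    have hn0 : (0 : ℝ) < n := by exact_mod_cast hp.trans_le hn
    have hk0 : (0 : ℝ) < (n / (L + m) : ℕ) := by exact_mod_cast hk
    have hp0 : (0 : ℝ) < (L + m : ℕ) := by exact_mod_cast hp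
    have hs0 : 0 ≤ s L := variance_nonneg _ _
    have hscale : charFun (P.map fun ω => (√((n / (L + m) : ℕ)))⁻¹ *
        ∑ j ∈ Finset.range (n / (L + m)), blockSum X m L j ω) (t / √((L + m : ℕ) * v)) =
        charFun (P.map fun ω => ∑ j ∈ Finset.range (n / (L + m)), blockSum X m L j ω)
          ((√((n / (L + m) : ℕ)))⁻¹ * (t / √((L + m : ℕ) * v))) :=
      charFun_map_mul_comp (Finset.aemeasurable_fun_sum _ fun j _ =>
        (hs.identDistrib_blockSum L j).aemeasurable_fst) _ _
    have h1 := h.norm_charFun_sum_range_sub_sum_blockSum_le hs h0 hmean hp n (t / (√n * √v))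
    have h2 := h.norm_charFun_sum_blockSum_sub_le hs h0 hmean L (n / (L + m)) (t / (√n * √v))
      ((√((n / (L + m) : ℕ)))⁻¹ * (t / √((L + m : ℕ) * v)))
    simp only [g]
    rw [hscale]
    refine (norm_sub_le_norm_sub_add_norm_sub _
      (charFun (P.map fun ω => ∑ j ∈ Finset.range (n / (L + m)), blockSum X m L j ω)
          ((√((n / (L + m) : ℕ)))⁻¹ * (t / √((L + m : ℕ) * v)))) _).trans ?_
    refine add_le_add ((norm_sub_le_norm_sub_add_norm_sub _ _ _).trans (add_le_add
      (h1.trans (le_of_eq ?_)) (h2.trans (le_of_eq ?_)))) le_rfl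
    · rw [abs_div, abs_of_pos (a := √n * √v) (by positivity), ← Real.sqrt_mul hn0.le,
        div_mul_eq_mul_div, mul_div_assoc, ← Real.sqrt_div' _ (by positivity)]
      congr 2
      simp only [C]
      field_simp
    · have h3 : t / (√n * √v) - (√((n / (L + m) : ℕ)))⁻¹ * (t / √((L + m : ℕ) * v)) =
          t * (√v)⁻¹ * (√((n / (L + m) : ℕ)))⁻¹ *
            (√(((n / (L + m) : ℕ) : ℝ) / n) - √(1 / (L + m : ℕ))) := by
        rw [Real.sqrt_div hk0.le, Real.sqrt_div zero_le_one, Real.sqrt_one,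
          Real.sqrt_mul hp0.le]
        have := Real.sqrt_pos.2 hk0
        field_simp
      rw [h3, abs_mul, abs_mul, abs_mul, abs_of_pos (a := (√v)⁻¹) (by positivity),
        abs_of_pos (a := (√((n / (L + m) : ℕ)))⁻¹) (by positivity), Real.sqrt_mul hk0.le,
        Real.sqrt_div hs0]
      have := Real.sqrt_pos.2 hk0
      simp only [s]
      field_simp
  have hg (L : ℕ) (hL : 0 < L) : Tendsto (g L) atTop (𝓝 (G L)) := by
    have hk := tendsto_natDiv_div_atTop (L + m)
    have hinv : Tendsto (fun n : ℕ => ((L : ℝ) + m) / n) atTop (𝓝 0) :=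
      tendsto_const_div_atTop_nhds_zero_nat _
    have hch := (h.tendsto_charFun_sum_blockSum hs h0 hmean L (t / √((L + m : ℕ) * v))).comp
      (Nat.tendsto_div_const_atTop (by omega : L + m ≠ 0))
    refine Tendsto.add (Tendsto.add ?_ ?_) ?_
    · exact ((((hk.mul_const _).add hinv).mul_const C).div_const v).sqrt.const_mul _
    · exact (hk.sqrt.sub_const _).abs.const_mul _
    · exact (hch.sub_const _).norm
  have hG : Tendsto G atTop (𝓝 0) := by
    have hinv : Tendsto (fun L : ℕ => (1 : ℝ) / (L + m : ℕ)) atTop (𝓝 0) :=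
      tendsto_one_div_atTop_nhds_zero_nat.comp (tendsto_add_atTop_nat m)
    have hsp : Tendsto (fun L : ℕ => s L / (L + m : ℕ)) atTop (𝓝 v) := by
      have hblock (L : ℕ) : blockSum X m L 0 = fun ω => ∑ i ∈ Finset.range L, X i ω := by
        funext ω
        simp [blockSum]
      simp only [s, hblock]
      exact h.tendsto_variance_sum_range_div hs h0
    have h1 : Tendsto (fun L : ℕ => |t| * √((1 / (L + m : ℕ) * m + 0) * C / v)) atTop
        (𝓝 (|t| * √((0 * m + 0) * C / v))) :=
      ((((hinv.mul_const _).add_const 0).mul_const C).div_const v).sqrt.const_mul _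
    have h2 : Tendsto (fun L : ℕ => ‖Complex.exp (-(s L / (L + m : ℕ) * (t ^ 2 / v) / 2 : ℝ)) -
        Complex.exp (-(t ^ 2 / 2 : ℝ))‖) atTop
        (𝓝 ‖Complex.exp (-(v * (t ^ 2 / v) / 2 : ℝ)) - Complex.exp (-(t ^ 2 / 2 : ℝ))‖) := by
      have h3 : Continuous fun x : ℝ => ‖Complex.exp (-(x * (t ^ 2 / v) / 2 : ℝ)) -
        Complex.exp (-(t ^ 2 / 2 : ℝ))‖ := by fun_prop
      exact (h3.tendsto v).comp hsp
    rw [mul_div_cancel₀ _ hv.ne', sub_self, norm_zero] at h2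
    have h12 := h1.add h2
    simp only [zero_mul, add_zero, zero_div, Real.sqrt_zero, mul_zero] at h12
    refine h12.congr fun L => ?_
    simp only [G, sub_self, abs_zero, mul_zero, add_zero]
    congr 6
    rw [div_pow, Real.sq_sqrt (by positivity)]
    ring_nf
  rw [tendsto_iff_norm_sub_tendsto_zero, Metric.tendsto_nhds]
  intro ε hε
  -- The block length is fixed first, and only then is `n` taken large.
  obtain ⟨L, hGL, hL⟩ := ((hG.eventually_lt_const hε).and (eventually_gt_atTop 0)).exists
  filter_upwards [(hg L hL).eventually_lt_const hGL, eventually_ge_atTop (L + m)] with n hn hnL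
  rw [Real.dist_eq, sub_zero, abs_norm]
  exact (hbound L n hL hnL).trans_lt hn

end CentralLimit

/-! ### Independent random indices and centring. -/

section RandomIndex

open scoped Topology

variable {Ω : Type*} [MeasurableSpace Ω] {P : Measure Ω}

lemma Measurable.comp_nat_index {E : Type*} [MeasurableSpace E] {U : Ω → E} {N : Ω → ℕ}
    (hU : Measurable U) (hN : Measurable N) {T : ℕ → E → ℝ} (hT : ∀ k, Measurable (T k)) :
    Measurable fun ω => T (N ω) (U ω) :=
  (measurable_from_prod_countable_left (f := fun q : E × ℕ => T q.2 q.1) hT).comp (hU.prodMk hN)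

/-- Freezing the index: mixing over an independent `ℕ`-valued variable. -/
lemma ProbabilityTheory.IndepFun.charFun_map_comp_nat_eq_integral [IsProbabilityMeasure P]
    {E : Type*} [MeasurableSpace E]
    {U : Ω → E} {N : Ω → ℕ} (hU : Measurable U) (hN : Measurable N) (h : IndepFun U N P)
    {T : ℕ → E → ℝ} (hT : ∀ k, Measurable (T k)) (t : ℝ) :
    charFun (P.map fun ω => T (N ω) (U ω)) t =
      ∫ ω, charFun (P.map fun ω' => T (N ω) (U ω')) t ∂P := by
  have hT' : Measurable fun q : E × ℕ => T q.2 q.1 := measurable_from_prod_countable_left hT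
  have hTN : Measurable fun ω => T (N ω) (U ω) := hU.comp_nat_index hN hT
  have hexp_real : Measurable fun x : ℝ => Complex.exp (t * x * Complex.I) := by fun_prop
  have hexp : Measurable fun q : E × ℕ => Complex.exp (t * T q.2 q.1 * Complex.I) :=
    hexp_real.comp hT'
  have : IsProbabilityMeasure (P.map U) := Measure.isProbabilityMeasure_map hU.aemeasurable
  have : IsProbabilityMeasure (P.map N) := Measure.isProbabilityMeasure_map hN.aemeasurable
  have hk (k : ℕ) : charFun (P.map fun ω' => T k (U ω')) t =
      ∫ x, Complex.exp (t * T k x * Complex.I) ∂(P.map U) := by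
    have hTk := hT k
    rw [charFun_apply_real, integral_map (by fun_prop) (by fun_prop),
      integral_map (by fun_prop) (by fun_prop)]
  simp only [hk]
  rw [← integral_map (φ := N)
    (f := fun k => ∫ x, Complex.exp (t * T k x * Complex.I) ∂(P.map U)) hN.aemeasurable
    (measurable_of_countable _).aestronglyMeasurable]
  rw [← integral_prod_symm (fun q : E × ℕ => Complex.exp (t * T q.2 q.1 * Complex.I)),
    ← h.map_prod_eq_prod_map_map hU.aemeasurable hN.aemeasurable,
    integral_map (by fun_prop) hexp.aestronglyMeasurable, charFun_apply_real,
    integral_map hTN.aemeasurable (by fun_prop)]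
  refine Integrable.of_bound hexp.aestronglyMeasurable 1 (ae_of_all _ fun q => ?_)
  rw [← Complex.ofReal_mul, Complex.norm_exp_ofReal_mul_I]

lemma tendsto_integral_comp_nat_of_ae_tendsto_atTop [IsProbabilityMeasure P]
    {N : ℕ → Ω → ℕ} (hN : ∀ n, Measurable (N n))
    (hlim : ∀ᵐ ω ∂P, Tendsto (fun n => N n ω) atTop atTop) {f : ℕ → ℂ} {c : ℂ} {b : ℝ}
    (hb : ∀ k, ‖f k‖ ≤ b) (hf : Tendsto f atTop (𝓝 c)) :
    Tendsto (fun n => ∫ ω, f (N n ω) ∂P) atTop (𝓝 c) := by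
  have := tendsto_integral_of_dominated_convergence (μ := P) (F := fun n ω => f (N n ω))
    (f := fun _ => c) (fun _ => b)
    (fun n => ((measurable_of_countable f).comp (hN n)).aestronglyMeasurable)
    (integrable_const _) (fun n => ae_of_all _ fun ω => hb _)
    (hlim.mono fun ω hω => hf.comp hω)
  simpa using this

lemma measurable_randomIndex {Y : ℕ → Ω → ℕ} (hY : ∀ i, Measurable (Y i)) (n : ℕ) :
    Measurable (randomIndex Y n) := by
  unfold randomIndex
  fun_prop

lemma ae_tendsto_randomIndex_atTop {Y : ℕ → Ω → ℕ} (hY_indep : iIndepFun Y P)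
    (hY_ident : ∀ i, IdentDistrib (Y i) (Y 0) P P) (hY_mean : 0 < ∫ ω, (Y 0 ω : ℝ) ∂P) :
    ∀ᵐ ω ∂P, Tendsto (fun n => randomIndex Y n ω) atTop atTop := by
  have hcast : Measurable (fun k : ℕ => (k : ℝ)) := measurable_of_countable _
  have hslln := strong_law_ae_real (μ := P) (fun i ω => (Y i ω : ℝ))
    -- A non-integrable function has integral `0` by convention, so a positive mean forces
    -- integrability.
    (Integrable.of_integral_ne_zero hY_mean.ne')
    (fun i j hij => (hY_indep.indepFun hij).comp hcast hcast)
    (fun i => (hY_ident i).comp hcast)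
  filter_upwards [hslln] with ω hω
  have h := hω.pos_mul_atTop hY_mean (tendsto_natCast_atTop_atTop (R := ℝ))
  rw [← tendsto_natCast_atTop_iff (R := ℝ)]
  refine h.congr' ?_
  filter_upwards [eventually_ge_atTop 1] with n hn
  have : (n : ℝ) ≠ 0 := by positivity
  rw [div_mul_cancel₀ _ this, randomIndex]
  push_cast
  rfl

/-- The central limit theorem for stationary `m`-dependent sequences, in terms of characteristic
functions. -/
lemma IsMDependentProcess.tendsto_charFun_sum_range_sub_div [IsProbabilityMeasure P]
    {X : ℕ → Ω → ℝ} {m : ℕ} (h : IsMDependentProcess m X P) (hs : IsStationaryProcess X P)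
    (h0 : MemLp (X 0) 2 P) (hv : 0 < longRunVariance m X P) (t : ℝ) :
    Tendsto (fun n : ℕ => charFun (P.map fun ω =>
        (∑ i ∈ Finset.range n, X i ω - n * ∫ ω', X 0 ω' ∂P) / (√n * √(longRunVariance m X P))) t)
      atTop (𝓝 (Complex.exp (-(t ^ 2 / 2 : ℝ)))) := by
  have hX1 (i : ℕ) : Integrable (X i) P := (hs.memLp h0 i).integrable one_le_two
  have hshift : Measurable fun x : ℝ => x - ∫ ω, X 0 ω ∂P := by fun_prop
  -- Centring leaves variances and covariances unchanged, which reduces the claim to mean zero.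
  have hlrv : longRunVariance m (fun i ω => X i ω - ∫ ω', X 0 ω' ∂P) P = longRunVariance m X P := by
    simp only [longRunVariance]
    rw [variance_sub_const (hX1 0).aestronglyMeasurable]
    congr 2
    refine Finset.sum_congr rfl fun j _ => ?_
    rw [covariance_sub_const_left (hX1 0), covariance_sub_const_right (hX1 j)]
  have hclt := (h.comp hshift).tendsto_charFun_sum_range_div (hs.comp hshift)
    (h0.sub (memLp_const _)) (by rw [integral_sub (hX1 0) (integrable_const _)]; simp)
    (by rw [hlrv]; exact hv) t
  rw [hlrv] at hclt
  refine hclt.congr fun n => ?_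
  have hmeas : AEMeasurable
      (fun ω => ∑ i ∈ Finset.range n, (X i ω - ∫ ω', X 0 ω' ∂P)) P :=
    Finset.aemeasurable_fun_sum _ fun i _ => (hX1 i).aemeasurable.sub_const _
  rw [div_eq_inv_mul, ← charFun_map_mul_comp hmeas]
  congr 2
  funext ω
  rw [Finset.sum_sub_distrib, div_eq_inv_mul]
  simp

lemma measurable_sum_range_sub_div (k : ℕ) (a v : ℝ) :
    Measurable fun x : ℕ → ℝ => (∑ i ∈ Finset.range k, x i - k * a) / (√k * √v) := by
  fun_prop

end RandomIndex

/-! ### The random-sum limit theorem. -/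

theorem theorem2p5 {Ω : Type*} [MeasurableSpace Ω] (P : Measure Ω) [IsProbabilityMeasure P]
    (m : ℕ) (X : ℕ → Ω → ℝ) (Y : ℕ → Ω → ℕ)
    (hX_meas : ∀ i, Measurable (X i))
    (hX_nonneg : ∀ i, ∀ᵐ ω ∂P, 0 ≤ X i ω)
    (hX_stat : IsStationaryProcess X P)
    (hX_dep : IsMDependentProcess m X P)
    (hX_mean : 0 < ∫ ω, X 0 ω ∂P)
    (hX_var : 0 < variance (X 0) P)
    (hX_lrv : 0 < longRunVariance m X P)
    (hX_third : Integrable (fun ω => |X 0 ω| ^ 3) P)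
    (hY_meas : ∀ i, Measurable (Y i))
    (hY_indep : iIndepFun Y P)
    (hY_ident : ∀ i, IdentDistrib (Y i) (Y 0) P P)
    (hY_mean : 0 < ∫ ω, (Y 0 ω : ℝ) ∂P)
    (hY_var : 0 < variance (fun ω => (Y 0 ω : ℝ)) P)
    (hY_third : Integrable (fun ω => |(Y 0 ω : ℝ)| ^ 3) P)
    (hXY : IndepFun (fun ω (i : ℕ) => X i ω) (fun ω (i : ℕ) => Y i ω) P) :
    TendstoInDistribution
      (fun (n : ℕ) (ω : Ω) =>
        (randomSum X Y n ω - (randomIndex Y n ω : ℝ) * ∫ ω', X 0 ω' ∂P) /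
          (Real.sqrt (randomIndex Y n ω : ℝ) * Real.sqrt (longRunVariance m X P)))
      atTop (id : ℝ → ℝ) (fun _ => P) (gaussianReal 0 1) := by
  have hX2 : MemLp (X 0) 2 P :=
    -- Outside L² the real-valued `variance` is `0` by convention, so a nonzero variance gives a
    -- second moment.
    memLp_two_of_variance_ne_zero (hX_meas 0).aestronglyMeasurable hX_var.ne'
  -- For `k = 0` division by zero makes this `0`, as the convention on `{N_n = 0}` requires.
  let T (k : ℕ) (x : ℕ → ℝ) : ℝ :=
    (∑ i ∈ Finset.range k, x i - k * ∫ ω, X 0 ω ∂P) / (√k * √(longRunVariance m X P))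
  have hT (k : ℕ) : Measurable (T k) := measurable_sum_range_sub_div k _ _
  have hN := measurable_randomIndex hY_meas
  have hXm : Measurable fun ω (i : ℕ) => X i ω := by fun_prop
  have hTN (n : ℕ) : Measurable fun ω => T (randomIndex Y n ω) fun i => X i ω :=
    hXm.comp_nat_index (hN n) hT
  have hind (n : ℕ) : IndepFun (fun ω (i : ℕ) => X i ω) (randomIndex Y n) P :=
    hXY.comp (ψ := fun y : ℕ → ℕ => ∑ i ∈ Finset.range n, y i) measurable_id (by fun_prop)
  have hcharFun (t : ℝ) : Tendsto
      (fun n => charFun (P.map fun ω => T (randomIndex Y n ω) fun i => X i ω) t) atTop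
      (nhds (charFun (gaussianReal 0 1) t)) := by
    have hlim := tendsto_integral_comp_nat_of_ae_tendsto_atTop hN
      (ae_tendsto_randomIndex_atTop hY_indep hY_ident hY_mean)
      (f := fun k => charFun (P.map fun ω => T k fun i => X i ω) t) (b := 1)
      (fun k => by
        have : IsProbabilityMeasure (P.map fun ω => T k fun i => X i ω) :=
          Measure.isProbabilityMeasure_map ((hT k).comp hXm).aemeasurable
        exact norm_charFun_le_one t)
      (hX_dep.tendsto_charFun_sum_range_sub_div hX_stat hX2 hX_lrv t)
    simp only [fun n => (hind n).charFun_map_comp_nat_eq_integral hXm (hN n) hT t]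
    convert hlim using 2
    rw [charFun_gaussianReal]
    push_cast
    simp
  refine ⟨fun n => (hTN n).aemeasurable, aemeasurable_id, ?_⟩
  refine ProbabilityMeasure.tendsto_iff_tendsto_charFun.2 fun t => ?_
  simp only [ProbabilityMeasure.coe_mk, Measure.map_id]
  exact hcharFun t
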